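/- Let $k,n,m$ be natural numbers with $m\ge 1$, let $E\subset\mathbb R^k$ be compact with Lebesgue measure $\mu(E)$, and let $\lambda>0$, $\rho>0$. Below $\|\cdot\|$ is the Euclidean norm on vectors and the induced operator norm on $n\times m$ matrices, and $\|\cdot\|_2$, $\|\cdot\|_\infty$ are the norms of $L_2$, $L_\infty$ over $E$ or $E\times E$ with Lebesgue measure. Consider $$x(\xi)=f(\xi,x(\xi))+\lambda\int_E\big[K_1(\xi,s,x(s))+K_2(\xi,s,x(s))\,u(s)\big]\,ds, \qquad (1)$$ where $f(\xi,x)\in\mathbb R^n$, $K_1(\xi,s,x)\in\mathbb R^n$, $K_2(\xi,s,x)\in\mathbb R^{n\times m}$ for $\xi,s\in E$, $x\in\mathbb R^n$, under the following conditions. (A) $f(\cdot,x)$ is Lebesgue measurable for every $x$, $f(\cdot,0)\in L_2(E;\mathbb R^n)$, and there is $\gamma_0\in L_\infty(E;\mathbb R)$ such that for a.a. $\xi$: $\|f(\xi,x_1)-f(\xi,x_2)\|\le\gamma_0(\xi)\|x_1-x_2\|$ for all $x_1,x_2\in\mathbb R^n$. (B) $K_1(\cdot,\cdot,x)$ is Lebesgue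 measurable for every $x$, $K_1(\cdot,\cdot,0)\in L_2(E\times E;\mathbb R^n)$, and there is $\gamma_1\in L_2(E\times E;\mathbb R)$ such that for a.a. $(\xi,s)$: $\|K_1(\xi,s,x_1)-K_1(\xi,s,x_2)\|\le\gamma_1(\xi,s)\|x_1-x_2\|$ for all $x_1,x_2$. (C) $K_2(\cdot,\cdot,x)$ is Lebesgue measurable for every $x$, $K_2(\cdot,\cdot,0)\in L_2(E\times E;\mathbb R^{n\times m})$, and there is $\gamma_2\in L_\infty(E\times E;\mathbb R)$ such that for a.a. $(\xi,s)$: $\|K_2(\xi,s,x_1)-K_2(\xi,s,x_2)\|\le\gamma_2(\xi,s)\|x_1-x_2\|$ for all $x_1,x_2$. (D) $6\big[\kappa_0^2+\lambda^2\kappa_1^2+\lambda^2\rho^2\kappa_2^2\mu(E)\big]<1$, where $\kappa_0=\|\gamma_0\|_\infty$, $\kappa_1=\|\gamma_1\|_2$, $\kappa_2=\|\gamma_2\|_\infty$. Let $V_\rho=\{u\in L_2(E;\mathbb R^m):\|u\|_2\le\rho\}$. A trajectory generated by $u\in V_\rho$ is a function $x\in L_2(E;\mathbb R^n)$ satisfying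 (1) for a.a. $\xi\in E$. Let $Z_\rho\subset L_2(E;\mathbb R^n)$ be the set of all trajectories generated by all $u\in V_\rho$, and put $$c_*=\left[\frac{16\lambda^2\rho^2\big[(\kappa_2+1)^2\mu(E)+1\big]}{(1-\kappa_0)^2-4\lambda^2\big[\kappa_1^2+\rho^2\kappa_2^2\mu(E)\big]}\right]^{1/2}.$$ A finite $\Delta$-partition of $E$ is a finite system $\Gamma=\{E_1,\dots,E_N\}$ of pairwise disjoint Lebesgue measurable sets of diameter at most $\Delta$ with union $E$. For $\alpha>0$, a uniform partition of $[0,\alpha]$ with step $\delta$ is $\Lambda=\{0=r_0,r_1,\dots,r_q=\alpha\}$ with $r_{j+1}-r_j=\delta$ for $j=0,\dots,q-1$. A finite $\sigma$-net of the unit sphere $S\subset\mathbb R^m$ is a finite set $S_\sigma\subset S$ such that each point of $S$ is at distance at most $\sigma$ from a point of $S_\sigma$. Given these, let $V_\rho^{\alpha,\Gamma,\Lambda,\sigma}$ be the set of all $u\in L_2(E;\mathbb R^m)$ for which there are $r_{j_i}\in\Lambda$, $b_{l_i}\in S_\sigma$ $(i=1,\dots,N)$ with $u(s)=r_{j_i}b_{l_i}$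 for $s\in E_i$ and $\sum_{i=1}^N\mu(E_i)r_{j_i}^2\le\rho^2$, and let $Z_\rho^{\alpha,\Gamma,\Lambda,\sigma}$ be the set of trajectories generated by the controls in $V_\rho^{\alpha,\Gamma,\Lambda,\sigma}$. **Theorem.** For every $\varepsilon>0$ there exist $\alpha_*=\alpha_*(\varepsilon)>0$, $\Delta_*=\Delta_*(\varepsilon)>0$, $\delta_*=\delta_*(\varepsilon)>0$ and $\sigma_*=\sigma_*(\varepsilon,\alpha_*)>0$ such that for all $\Delta\in(0,\Delta_*]$, $\delta\in(0,\delta_*]$, $\sigma\in(0,\sigma_*]$, every finite $\Delta$-partition $\Gamma$ of $E$, every uniform partition $\Lambda$ of $[0,\alpha_*]$ with step $\delta$, and every finite $\sigma$-net $S_\sigma$ of $S$, the set $Z_\rho^{\alpha_*,\Gamma,\Lambda,\sigma}$ is a nonempty finite subset of $Z_\rho$, and $$h_2\big(Z_\rho,\,Z_\rho^{\alpha_*,\Gamma,\Lambda,\sigma}\big)\le(c_*+1)\,\varepsilon,$$ where $h_2$ is the Hausdorff distance between subsets of $L_2(E;\mathbb R^n)$. -/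

import Mathlib

open MeasureTheory Set
open scoped ENNReal

noncomputable section

/-- The data of the control system
`x(ξ) = f(ξ, x(ξ)) + lam * ∫_E [K₁(ξ,s,x(s)) + K₂(ξ,s,x(s)) u(s)] ds`
with `E ⊆ ℝᵏ`, state in `ℝⁿ` and control in `ℝᵐ` (Euclidean norms). The `n × m` matrices are
the linear maps from `ℝᵐ` to `ℝⁿ`, with the operator norm. Only the values of `f`, `K₁`, `K₂` for
`ξ, s ∈ E` play a role. -/
structure UrysohnSystem (k n m : ℕ) where
  E : Set (EuclideanSpace ℝ (Fin k))
  f : EuclideanSpace ℝ (Fin k) → EuclideanSpace ℝ (Fin n) → EuclideanSpace ℝ (Fin n)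
  K₁ : EuclideanSpace ℝ (Fin k) → EuclideanSpace ℝ (Fin k) →
    EuclideanSpace ℝ (Fin n) → EuclideanSpace ℝ (Fin n)
  K₂ : EuclideanSpace ℝ (Fin k) → EuclideanSpace ℝ (Fin k) → EuclideanSpace ℝ (Fin n) →
    (EuclideanSpace ℝ (Fin m) →L[ℝ] EuclideanSpace ℝ (Fin n))
  lam : ℝ

namespace UrysohnSystem

variable {k n m : ℕ}

/-- Lebesgue measure on `E`. Lebesgue measurability of a function on `E` is
`AEStronglyMeasurable` with respect to this measure (equality a.e. with a Borel function). -/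
abbrev μE (S : UrysohnSystem k n m) : Measure (EuclideanSpace ℝ (Fin k)) :=
  volume.restrict S.E

/-- Lebesgue measure on `E × E`. -/
abbrev μEE (S : UrysohnSystem k n m) :
    Measure (EuclideanSpace ℝ (Fin k) × EuclideanSpace ℝ (Fin k)) :=
  S.μE.prod S.μE

/-- The space `L₂(E; ℝᵐ)` of controls. -/
abbrev ControlSpace (S : UrysohnSystem k n m) :=
  Lp (EuclideanSpace ℝ (Fin m)) 2 S.μE

/-- The space `L₂(E; ℝⁿ)` of states. -/
abbrev StateSpace (S : UrysohnSystem k n m) :=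
  Lp (EuclideanSpace ℝ (Fin n)) 2 S.μE

/-- Condition on `f`, with Lipschitz modulus `γ₀ ∈ L_∞(E)`. -/
structure CondA (S : UrysohnSystem k n m) (γ₀ : EuclideanSpace ℝ (Fin k) → ℝ) : Prop where
  measurable : ∀ x, AEStronglyMeasurable (fun ξ => S.f ξ x) S.μE
  zero_mem : MemLp (fun ξ => S.f ξ 0) 2 S.μE
  gamma_mem : MemLp γ₀ ∞ S.μE
  lipschitz : ∀ᵐ ξ ∂S.μE, ∀ x₁ x₂, ‖S.f ξ x₁ - S.f ξ x₂‖ ≤ γ₀ ξ * ‖x₁ - x₂‖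

/-- Condition on `K₁`, with Lipschitz modulus `γ₁ ∈ L₂(E × E)`. -/
structure CondB (S : UrysohnSystem k n m)
    (γ₁ : EuclideanSpace ℝ (Fin k) × EuclideanSpace ℝ (Fin k) → ℝ) : Prop where
  measurable : ∀ x, AEStronglyMeasurable (fun p => S.K₁ p.1 p.2 x) S.μEE
  zero_mem : MemLp (fun p => S.K₁ p.1 p.2 0) 2 S.μEE
  gamma_mem : MemLp γ₁ 2 S.μEE
  lipschitz : ∀ᵐ p ∂S.μEE, ∀ x₁ x₂,
    ‖S.K₁ p.1 p.2 x₁ - S.K₁ p.1 p.2 x₂‖ ≤ γ₁ p * ‖x₁ - x₂‖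

/-- Condition on `K₂`, with Lipschitz modulus `γ₂ ∈ L_∞(E × E)`. -/
structure CondC (S : UrysohnSystem k n m)
    (γ₂ : EuclideanSpace ℝ (Fin k) × EuclideanSpace ℝ (Fin k) → ℝ) : Prop where
  measurable : ∀ x, AEStronglyMeasurable (fun p => S.K₂ p.1 p.2 x) S.μEE
  zero_mem : MemLp (fun p => S.K₂ p.1 p.2 0) 2 S.μEE
  gamma_mem : MemLp γ₂ ∞ S.μEE
  lipschitz : ∀ᵐ p ∂S.μEE, ∀ x₁ x₂,
    ‖S.K₂ p.1 p.2 x₁ - S.K₂ p.1 p.2 x₂‖ ≤ γ₂ p * ‖x₁ - x₂‖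

/-- `κ₀`, the `L_∞(E)` norm of `γ₀`. -/
def kappa₀ (S : UrysohnSystem k n m) (γ₀ : EuclideanSpace ℝ (Fin k) → ℝ) : ℝ :=
  (eLpNorm γ₀ ∞ S.μE).toReal

/-- `κ₁`, the `L₂(E × E)` norm of `γ₁`. -/
def kappa₁ (S : UrysohnSystem k n m)
    (γ₁ : EuclideanSpace ℝ (Fin k) × EuclideanSpace ℝ (Fin k) → ℝ) : ℝ :=
  (eLpNorm γ₁ 2 S.μEE).toReal

/-- `κ₂`, the `L_∞(E × E)` norm of `γ₂`. -/
def kappa₂ (S : UrysohnSystem k n m)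
    (γ₂ : EuclideanSpace ℝ (Fin k) × EuclideanSpace ℝ (Fin k) → ℝ) : ℝ :=
  (eLpNorm γ₂ ∞ S.μEE).toReal

/-- The smallness condition, for given `ρ, κ₀, κ₁, κ₂`. -/
def CondD (S : UrysohnSystem k n m) (ρ κ₀ κ₁ κ₂ : ℝ) : Prop :=
  6 * (κ₀ ^ 2 + S.lam ^ 2 * κ₁ ^ 2 + S.lam ^ 2 * ρ ^ 2 * κ₂ ^ 2 * volume.real S.E) < 1

/-- The constant `c_*`. -/
def cStar (S : UrysohnSystem k n m) (ρ κ₀ κ₁ κ₂ : ℝ) : ℝ :=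
  Real.sqrt ((16 * S.lam ^ 2 * ρ ^ 2 * ((κ₂ + 1) ^ 2 * volume.real S.E + 1)) /
    ((1 - κ₀) ^ 2 - 4 * S.lam ^ 2 * (κ₁ ^ 2 + ρ ^ 2 * κ₂ ^ 2 * volume.real S.E)))

/-- `x ∈ L₂(E; ℝⁿ)` is a trajectory generated by the control `u`: for almost every `ξ ∈ E` the
integral in the equation exists and the equation holds. -/
def IsTrajectory (S : UrysohnSystem k n m) (u : S.ControlSpace) (x : S.StateSpace) : Prop :=
  ∀ᵐ ξ ∂S.μE,
    Integrable (fun s => S.K₁ ξ s (x s) + S.K₂ ξ s (x s) (u s)) S.μE ∧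
    x ξ = S.f ξ (x ξ) + S.lam • ∫ s in S.E, (S.K₁ ξ s (x s) + S.K₂ ξ s (x s) (u s))

/-- The trajectories generated by the controls of a set `V`. -/
def trajectories (S : UrysohnSystem k n m) (V : Set S.ControlSpace) : Set S.StateSpace :=
  {x | ∃ u ∈ V, S.IsTrajectory u x}

/-- `V_ρ`, the admissible controls: the closed ball of radius `ρ` in `L₂(E; ℝᵐ)`. -/
def admissible (S : UrysohnSystem k n m) (ρ : ℝ) : Set S.ControlSpace :=
  {u | ‖u‖ ≤ ρ}

/-- `Z_ρ`, the set of trajectories of the system. -/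
def Z (S : UrysohnSystem k n m) (ρ : ℝ) : Set S.StateSpace :=
  S.trajectories (S.admissible ρ)

/-- The controls equal to `r_{j_i} b_{l_i}` on the `i`-th set of the partition `Γ` of `E`, with
`r_{j_i}` among the points `r` of the partition of `[0, α]`, `b_{l_i}` in the finite set `B` of
unit vectors, and `∑ μ(E_i) r_{j_i}² ≤ ρ²`. (Elements of `L₂` are classes modulo a.e. equality.) -/
def discreteControls (S : UrysohnSystem k n m) (ρ : ℝ) {N q : ℕ}
    (Γ : Fin N → Set (EuclideanSpace ℝ (Fin k))) (r : Fin (q + 1) → ℝ)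
    (B : Finset (EuclideanSpace ℝ (Fin m))) : Set S.ControlSpace :=
  {u | ∃ (j : Fin N → Fin (q + 1)) (b : Fin N → EuclideanSpace ℝ (Fin m)),
    (∀ i, b i ∈ B) ∧
    (∀ i, ∀ᵐ s ∂S.μE, s ∈ Γ i → u s = r (j i) • b i) ∧
    ∑ i, volume.real (Γ i) * r (j i) ^ 2 ≤ ρ ^ 2}

/-- The trajectories generated by the controls in `discreteControls`. -/
def discreteZ (S : UrysohnSystem k n m) (ρ : ℝ) {N q : ℕ}
    (Γ : Fin N → Set (EuclideanSpace ℝ (Fin k))) (r : Fin (q + 1) → ℝ)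
    (B : Finset (EuclideanSpace ℝ (Fin m))) : Set S.StateSpace :=
  S.trajectories (S.discreteControls ρ Γ r B)

end UrysohnSystem

/-- `P` is a finite `Δ`-partition of `Q`: Lebesgue measurable pairwise disjoint sets with union
`Q`, each of diameter at most `Δ`. -/
structure IsDeltaPartition {k N : ℕ} (Q : Set (EuclideanSpace ℝ (Fin k))) (Δ : ℝ)
    (P : Fin N → Set (EuclideanSpace ℝ (Fin k))) : Prop where
  subset : ∀ i, P i ⊆ Q
  measurable : ∀ i, NullMeasurableSet (P i) volume
  disjoint : ∀ i j, i ≠ j → P i ∩ P j = ∅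
  union : Q = ⋃ i, P i
  diam_le : ∀ i, ∀ x ∈ P i, ∀ y ∈ P i, ‖x - y‖ ≤ Δ

/-- `0 = r₀, r₁, …, r_q = α` is a uniform partition of `[0, α]` with step `δ`. -/
structure IsUniformPartition {q : ℕ} (α δ : ℝ) (r : Fin (q + 1) → ℝ) : Prop where
  first : r 0 = 0
  last : r (Fin.last q) = α
  step : ∀ j : Fin q, r j.succ - r j.castSucc = δ

/-- `B` is a finite `σ`-net on the unit sphere of `ℝᵐ`. -/
structure IsSphereNet {m : ℕ} (σ : ℝ) (B : Finset (EuclideanSpace ℝ (Fin m))) : Prop where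
  norm_eq : ∀ b ∈ B, ‖b‖ = 1
  cover : ∀ x : EuclideanSpace ℝ (Fin m), ‖x‖ = 1 → ∃ b ∈ B, ‖x - b‖ ≤ σ

end

open Filter Topology

/-! The control enters linearly, through a square integrable kernel, so weak convergence of controls
becomes norm convergence of trajectories. Three facts carry the argument.

Under condition (D) the right-hand side of the equation is a contraction of `L₂` for each admissible
control, so each control has exactly one trajectory (`existsUnique_isTrajectory`). An integral
operator with square integrable kernel turns weak into norm convergence; combined with the
contraction this makes the control-to-trajectory map weak-to-norm sequentially continuous
(`tendsto_trajectory_of_weak`). Since the ball of controls is weakly sequentially compact, `Z ρ` is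
compact (`isSeqCompact_Z`).

Discrete controls are dense in the ball, in a form uniform over all fine enough partitions and nets
(`exists_discreteControls_near`), but the thresholds depend on the control. Compactness removes this
dependence: a finite `ε / 2`-net of `Z ρ` leaves finitely many thresholds, so one `αs` and one mesh
bound serve them all. Every trajectory then lies within `ε` of a discrete one, and discrete
trajectories already belong to `Z ρ`. The distance is thus at most `ε`; of `cStar` only
nonnegativity matters. -/

/-! ### Measurability and `L₂` estimates for integral operators. -/

/-- Carathéodory's argument: for simple `x` the composition is a finite sum of indicators, and
continuity in the second variable passes to the limit along simple approximations. -/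
theorem aestronglyMeasurable_comp_of_continuous {α F G : Type*} [MeasurableSpace α]
    {μ : Measure α} [NormedAddCommGroup F] [NormedAddCommGroup G]
    {h : α → F → G} (hm : ∀ x, AEStronglyMeasurable (fun a => h a x) μ)
    (hc : ∀ᵐ a ∂μ, Continuous (h a)) {x : α → F} (hx : AEStronglyMeasurable x μ) :
    AEStronglyMeasurable (fun a => h a (x a)) μ := by
  have hsimple : ∀ φ : SimpleFunc α F, AEStronglyMeasurable (fun a => h a (φ a)) μ := by
    intro φ
    classical
    have hrw : (fun a => h a (φ a)) =
        fun a => ∑ y ∈ φ.range, (φ ⁻¹' {y}).indicator (fun a => h a y) a := by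
      funext a
      rw [Finset.sum_eq_single (φ a)]
      · simp
      · intro b _ hb
        exact indicator_of_notMem (by simpa using hb.symm) _
      · intro hn
        exact absurd (φ.mem_range_self a) hn
    rw [hrw]
    exact Finset.aestronglyMeasurable_fun_sum _ fun y _ =>
      (hm y).indicator (φ.measurableSet_fiber y)
  refine aestronglyMeasurable_of_tendsto_ae atTop
    (fun j => hsimple (hx.stronglyMeasurable_mk.approx j)) ?_
  filter_upwards [hc, hx.ae_eq_mk] with a ha hxa
  rw [hxa]
  exact (ha.tendsto _).comp (hx.stronglyMeasurable_mk.tendsto_approx a)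

theorem eLpNorm_two_sq {α G : Type*} [MeasurableSpace α] (μ : Measure α) [NormedAddCommGroup G]
    (g : α → G) : eLpNorm g 2 μ ^ 2 = ∫⁻ a, ‖g a‖ₑ ^ 2 ∂μ := by
  have h := eLpNorm_nnreal_pow_eq_lintegral (μ := μ) (f := g) (p := 2) two_ne_zero
  have h2 : ((2 : NNReal) : ℝ) = ((2 : ℕ) : ℝ) := by norm_num
  rw [h2] at h
  simp only [ENNReal.rpow_natCast] at h
  exact_mod_cast h

theorem lintegral_enorm_mul_le_eLpNorm_two {α G H : Type*} [MeasurableSpace α] {μ : Measure α}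
    [NormedAddCommGroup G] [NormedAddCommGroup H] {g : α → G} {h : α → H}
    (hg : AEStronglyMeasurable g μ) (hh : AEStronglyMeasurable h μ) :
    ∫⁻ a, ‖g a‖ₑ * ‖h a‖ₑ ∂μ ≤ eLpNorm g 2 μ * eLpNorm h 2 μ := by
  have := ENNReal.lintegral_mul_le_Lp_mul_Lq μ (Real.HolderConjugate.two_two) hg.enorm hh.enorm
  rw [eLpNorm_eq_lintegral_rpow_enorm_toReal (by norm_num) (by norm_num),
    eLpNorm_eq_lintegral_rpow_enorm_toReal (by norm_num) (by norm_num)]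
  simpa using this

theorem lintegral_eLpNorm_two_sq_prod {α β G : Type*} [MeasurableSpace α] [MeasurableSpace β]
    {μ : Measure α} {ν : Measure β} [SFinite ν] [NormedAddCommGroup G] {k : α × β → G}
    (hk : AEStronglyMeasurable k (μ.prod ν)) :
    ∫⁻ a, eLpNorm (fun b => k (a, b)) 2 ν ^ 2 ∂μ = eLpNorm k 2 (μ.prod ν) ^ 2 := by
  simp_rw [eLpNorm_two_sq]
  rw [lintegral_prod _ (hk.enorm.pow_const 2)]

theorem ae_memLp_two_of_prod {α β G : Type*} [MeasurableSpace α] [MeasurableSpace β]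
    {μ : Measure α} {ν : Measure β} [SFinite ν] [NormedAddCommGroup G] {k : α × β → G}
    (hk : MemLp k 2 (μ.prod ν)) : ∀ᵐ a ∂μ, MemLp (fun b => k (a, b)) 2 ν := by
  have hfin : ∫⁻ a, eLpNorm (fun b => k (a, b)) 2 ν ^ 2 ∂μ ≠ ∞ := by
    rw [lintegral_eLpNorm_two_sq_prod hk.1]
    exact ENNReal.pow_ne_top hk.2.ne
  have hmeas : AEMeasurable (fun a => eLpNorm (fun b => k (a, b)) 2 ν ^ 2) μ := by
    simp_rw [eLpNorm_two_sq]
    exact (hk.1.enorm.pow_const 2).lintegral_prod_right'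
  filter_upwards [hk.1.prodMk_left, ae_lt_top' hmeas hfin] with a ha hlt
  refine ⟨ha, ?_⟩
  by_contra hcon
  rw [not_lt, top_le_iff] at hcon
  simp [hcon] at hlt

/-- The Hilbert–Schmidt estimate for an integral operator whose integrand is dominated by a
square integrable kernel times a square integrable function. -/
theorem integral_kernel_dominated {α β F G H : Type*} [MeasurableSpace α] [MeasurableSpace β]
    {μ : Measure α} {ν : Measure β} [SFinite μ] [SFinite ν] [NormedAddCommGroup F]
    [NormedAddCommGroup G] [NormedAddCommGroup H] [NormedSpace ℝ H]
    {k : α × β → F} {w : β → G} {J : α × β → H} (hk : MemLp k 2 (μ.prod ν)) (hw : MemLp w 2 ν)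
    (hJ : AEStronglyMeasurable J (μ.prod ν)) (hle : ∀ᵐ p ∂μ.prod ν, ‖J p‖ ≤ ‖k p‖ * ‖w p.2‖) :
    (∀ᵐ a ∂μ, Integrable (fun b => J (a, b)) ν) ∧
      MemLp (fun a => ∫ b, J (a, b) ∂ν) 2 μ ∧
      eLpNorm (fun a => ∫ b, J (a, b) ∂ν) 2 μ ≤ eLpNorm k 2 (μ.prod ν) * eLpNorm w 2 ν := by
  have hpt : ∀ᵐ a ∂μ, ∫⁻ b, ‖J (a, b)‖ₑ ∂ν ≤ eLpNorm (fun b => k (a, b)) 2 ν * eLpNorm w 2 ν := by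
    filter_upwards [Measure.ae_ae_of_ae_prod hle, hk.1.prodMk_left] with a ha hka
    refine le_trans (lintegral_mono_ae ?_) (lintegral_enorm_mul_le_eLpNorm_two hka hw.1)
    filter_upwards [ha] with b hb
    rw [← enorm_norm (J (a, b)), ← enorm_norm (k (a, b)), ← enorm_norm (w b), ← enorm_mul]
    refine enorm_le_iff_norm_le.mpr ?_
    simpa using hb
  have hint : ∀ᵐ a ∂μ, Integrable (fun b => J (a, b)) ν := by
    filter_upwards [hpt, hJ.prodMk_left, ae_memLp_two_of_prod hk] with a ha hJa hka
    exact ⟨hJa, ha.trans_lt (ENNReal.mul_lt_top hka.2 hw.2)⟩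
  have hbound : eLpNorm (fun a => ∫ b, J (a, b) ∂ν) 2 μ ≤
      eLpNorm k 2 (μ.prod ν) * eLpNorm w 2 ν := by
    -- After squaring, Tonelli turns the kernel norm into the integral of its slice norms, and the
    -- slicewise Cauchy–Schwarz bound `hpt` applies under the integral.
    rw [← ENNReal.pow_le_pow_left_iff two_ne_zero, mul_pow, eLpNorm_two_sq,
      ← lintegral_eLpNorm_two_sq_prod hk.1, ← lintegral_mul_const' _ _ (ENNReal.pow_ne_top hw.2.ne)]
    refine lintegral_mono_ae ?_
    filter_upwards [hpt] with a ha
    rw [← mul_pow]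
    exact pow_le_pow_left' ((enorm_integral_le_lintegral_enorm _).trans ha) 2
  exact ⟨hint, ⟨hJ.integral_prod_right',
    hbound.trans_lt (ENNReal.mul_lt_top hk.2 hw.2)⟩, hbound⟩

/-- Dominated convergence for the squares. The majorant takes values in `ℝ≥0∞` so that slice norms
of a kernel can serve directly. -/
theorem tendsto_eLpNorm_two_of_dominated {α G : Type*} [MeasurableSpace α] {μ : Measure α}
    [NormedAddCommGroup G] {g : ℕ → α → G} (hg : ∀ j, AEStronglyMeasurable (g j) μ)
    {b : α → ℝ≥0∞} (hb : ∫⁻ a, b a ^ 2 ∂μ ≠ ∞) (hle : ∀ j, ∀ᵐ a ∂μ, ‖g j a‖ₑ ≤ b a)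
    (hlim : ∀ᵐ a ∂μ, Tendsto (fun j => g j a) atTop (𝓝 0)) :
    Tendsto (fun j => eLpNorm (g j) 2 μ) atTop (𝓝 0) := by
  have h2 : Tendsto (fun j => ∫⁻ a, ‖g j a‖ₑ ^ 2 ∂μ) atTop (𝓝 (∫⁻ _, 0 ∂μ)) := by
    refine tendsto_lintegral_of_dominated_convergence' (fun a => b a ^ 2)
      (fun j => (hg j).enorm.pow_const 2) (fun j => ?_) hb ?_
    · filter_upwards [hle j] with a ha using pow_le_pow_left' ha 2
    · filter_upwards [hlim] with a ha
      have := (ENNReal.continuous_pow 2).tendsto _ |>.comp ha.enorm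
      simpa [Function.comp_def] using this
  simp_rw [← eLpNorm_two_sq, lintegral_zero] at h2
  have h3 := (ENNReal.continuous_rpow_const (y := (1 / 2 : ℝ))).tendsto _ |>.comp h2
  rw [ENNReal.zero_rpow_of_pos (by norm_num)] at h3
  refine h3.congr fun j => ?_
  simp only [Function.comp_apply]
  rw [← ENNReal.rpow_natCast, ← ENNReal.rpow_mul]
  norm_num

theorem integrable_clm_apply_of_memLp {α F G : Type*} [MeasurableSpace α] {μ : Measure α}
    [NormedAddCommGroup F] [NormedSpace ℝ F] [NormedAddCommGroup G] [NormedSpace ℝ G]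
    {k : α → F →L[ℝ] G} (hk : MemLp k 2 μ) {v : α → F} (hv : MemLp v 2 μ) :
    Integrable (fun a => k a (v a)) μ := by
  refine Integrable.mono' (hk.norm.integrable_mul hv.norm)
    (isBoundedBilinearMap_apply.continuous.comp_aestronglyMeasurable (hk.1.prodMk hv.1))
    (Eventually.of_forall fun a => ?_)
  exact (k a).le_opNorm (v a)

/-- Integral operators with square integrable kernels send weakly convergent sequences to
convergent ones. -/
theorem tendsto_integral_clm_apply_of_weak {α F G : Type*} [MeasurableSpace α] {μ : Measure α}
    [NormedAddCommGroup F] [InnerProductSpace ℝ F] [FiniteDimensional ℝ F]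
    [NormedAddCommGroup G] [InnerProductSpace ℝ G] [FiniteDimensional ℝ G]
    {k : α → F →L[ℝ] G} (hk : MemLp k 2 μ) {u : ℕ → Lp F 2 μ} {u₀ : Lp F 2 μ}
    (hu : ∀ w : Lp F 2 μ, Tendsto (fun j => inner ℝ w (u j)) atTop (𝓝 (inner ℝ w u₀))) :
    Tendsto (fun j => ∫ a, k a (u j a) ∂μ) atTop (𝓝 (∫ a, k a (u₀ a) ∂μ)) := by
  -- Each component of the integral is an inner product with the `L₂` function `a ↦ (k a)* e`, hence
  -- weakly continuous in `v`; finitely many components determine the integral.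
  have key : ∀ e : G, ∃ w : Lp F 2 μ, ∀ v : Lp F 2 μ,
      inner ℝ e (∫ a, k a (v a) ∂μ) = inner ℝ w v := by
    intro e
    have hw : MemLp (fun a => ContinuousLinearMap.adjoint (k a) e) 2 μ := by
      refine MemLp.of_le_mul (c := ‖e‖) hk ?_ (Eventually.of_forall fun a => ?_)
      · exact (ContinuousLinearMap.adjoint.continuous.comp_aestronglyMeasurable
          hk.1).apply_continuousLinearMap e
      · rw [mul_comm]
        exact (ContinuousLinearMap.le_opNorm _ e).trans_eq (by simp)
    refine ⟨hw.toLp _, fun v => ?_⟩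
    rw [L2.inner_def, ← integral_inner (integrable_clm_apply_of_memLp hk (Lp.memLp v))]
    refine integral_congr_ae ?_
    filter_upwards [hw.coeFn_toLp] with a ha
    rw [ha, ContinuousLinearMap.adjoint_inner_left]
  let b := stdOrthonormalBasis ℝ G
  have hrepr : ∀ y : G, y = ∑ i, inner ℝ (b i) y • b i := fun y => (b.sum_repr' y).symm
  rw [hrepr (∫ a, k a (u₀ a) ∂μ)]
  refine Tendsto.congr (fun j => (hrepr _).symm) ?_
  refine tendsto_finsetSum _ fun i _ => ?_
  obtain ⟨w, hw⟩ := key (b i)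
  simp_rw [hw]
  exact (hu w).smul_const _

/-- Common source of the Lipschitz bounds of both integral terms, with `w` the difference of two
states and `k` either `γ₁` or a multiple of the control. -/
theorem Lp.norm_sub_le_of_kernel_dominated {α β F G H : Type*} [MeasurableSpace α]
    [MeasurableSpace β] {μ : Measure α} {ν : Measure β} [SFinite μ] [SFinite ν]
    [NormedAddCommGroup F] [NormedAddCommGroup G] [NormedAddCommGroup H] [NormedSpace ℝ H]
    {k : α × β → F} {w : β → G} {J₁ J₂ : α × β → H} {z₁ z₂ : Lp H 2 μ}
    (hk : MemLp k 2 (μ.prod ν)) (hw : MemLp w 2 ν)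
    (hJ₁ : AEStronglyMeasurable J₁ (μ.prod ν)) (hJ₂ : AEStronglyMeasurable J₂ (μ.prod ν))
    (hi₁ : ∀ᵐ a ∂μ, Integrable (fun b => J₁ (a, b)) ν)
    (hi₂ : ∀ᵐ a ∂μ, Integrable (fun b => J₂ (a, b)) ν)
    (hz₁ : z₁ =ᵐ[μ] fun a => ∫ b, J₁ (a, b) ∂ν) (hz₂ : z₂ =ᵐ[μ] fun a => ∫ b, J₂ (a, b) ∂ν)
    (hle : ∀ᵐ p ∂μ.prod ν, ‖J₁ p - J₂ p‖ ≤ ‖k p‖ * ‖w p.2‖) :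
    ‖z₁ - z₂‖ ≤ (eLpNorm k 2 (μ.prod ν)).toReal * (eLpNorm w 2 ν).toReal := by
  have hz : ⇑(z₁ - z₂) =ᵐ[μ] fun a => ∫ b, (J₁ (a, b) - J₂ (a, b)) ∂ν := by
    filter_upwards [Lp.coeFn_sub z₁ z₂, hz₁, hz₂, hi₁, hi₂] with a h1 h2 h3 h4 h5
    rw [h1, Pi.sub_apply, h2, h3, integral_sub h4 h5]
  rw [Lp.norm_def, eLpNorm_congr_ae hz, ← ENNReal.toReal_mul]
  exact ENNReal.toReal_mono (ENNReal.mul_lt_top hk.2 hw.2).ne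
    (integral_kernel_dominated hk hw (hJ₁.sub hJ₂) hle).2.2

theorem memLp_of_norm_sub_le {α F G : Type*} [MeasurableSpace α] {μ : Measure α}
    [NormedAddCommGroup F] [NormedAddCommGroup G] {f g : α → F} {w : α → G} {p : ℝ≥0∞} {c : ℝ}
    (hf : AEStronglyMeasurable f μ) (hg : MemLp g p μ) (hw : MemLp w p μ)
    (h : ∀ᵐ a ∂μ, ‖f a - g a‖ ≤ c * ‖w a‖) : MemLp f p μ :=
  ((MemLp.of_le_mul hw (hf.sub hg.1) h).add hg).ae_eq
    (Eventually.of_forall fun _ => sub_add_cancel _ _)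

theorem ae_le_toReal_eLpNorm_top {α : Type*} [MeasurableSpace α] {μ : Measure α} {γ : α → ℝ}
    (hγ : MemLp γ ∞ μ) : ∀ᵐ a ∂μ, γ a ≤ (eLpNorm γ ∞ μ).toReal := by
  rw [eLpNorm_exponent_top]
  have hfin : eLpNormEssSup γ μ ≠ ∞ := by simpa using hγ.2.ne
  filter_upwards [ae_le_eLpNormEssSup (f := γ) (μ := μ)] with a ha
  have := ENNReal.toReal_mono hfin ha
  rw [toReal_enorm] at this
  exact (le_abs_self _).trans this

theorem toReal_eLpNorm_two_comp_snd {α β F : Type*} [MeasurableSpace α] [MeasurableSpace β]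
    {μ : Measure α} {ν : Measure β} [IsFiniteMeasure μ] [SFinite ν] [NormedAddCommGroup F]
    {w : β → F} (hw : MemLp w 2 ν) :
    (eLpNorm (fun p : α × β => w p.2) 2 (μ.prod ν)).toReal =
      (eLpNorm w 2 ν).toReal * Real.sqrt (μ.real univ) := by
  rw [← sq_eq_sq₀ ENNReal.toReal_nonneg (by positivity), mul_pow, Real.sq_sqrt measureReal_nonneg,
    ← ENNReal.toReal_pow, ← ENNReal.toReal_pow,
    ← lintegral_eLpNorm_two_sq_prod (k := fun p : α × β => w p.2) hw.1.comp_snd]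
  dsimp only
  rw [lintegral_const, ENNReal.toReal_mul]
  rfl

/-! ### The operators of the state equation on `L₂`. -/

namespace UrysohnSystem

variable {k n m : ℕ} {S : UrysohnSystem k n m} {γ₀ : EuclideanSpace ℝ (Fin k) → ℝ}
  {γ₁ γ₂ : EuclideanSpace ℝ (Fin k) × EuclideanSpace ℝ (Fin k) → ℝ}

theorem isFiniteMeasure_μE (hE : IsCompact S.E) : IsFiniteMeasure S.μE :=
  isFiniteMeasure_restrict.mpr hE.measure_lt_top.ne

section Nemytskii

theorem CondA.aestronglyMeasurable_comp (hA : S.CondA γ₀)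
    {x : EuclideanSpace ℝ (Fin k) → EuclideanSpace ℝ (Fin n)}
    (hx : AEStronglyMeasurable x S.μE) : AEStronglyMeasurable (fun ξ => S.f ξ (x ξ)) S.μE := by
  refine aestronglyMeasurable_comp_of_continuous hA.measurable ?_ hx
  filter_upwards [hA.lipschitz] with ξ hξ
  exact (LipschitzWith.of_dist_le' (K := γ₀ ξ) fun a b => by
    simpa [dist_eq_norm] using hξ a b).continuous

theorem CondB.aestronglyMeasurable_comp (hB : S.CondB γ₁)
    {x : EuclideanSpace ℝ (Fin k) → EuclideanSpace ℝ (Fin n)}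
    (hx : AEStronglyMeasurable x S.μE) :
    AEStronglyMeasurable (fun p => S.K₁ p.1 p.2 (x p.2)) S.μEE := by
  refine aestronglyMeasurable_comp_of_continuous 
    (h := fun p : EuclideanSpace ℝ (Fin k) × EuclideanSpace ℝ (Fin k) => S.K₁ p.1 p.2)
    (x := fun p => x p.2) hB.measurable ?_ hx.comp_snd
  filter_upwards [hB.lipschitz] with p hp
  exact (LipschitzWith.of_dist_le' (K := γ₁ p) fun a b => by
    simpa [dist_eq_norm] using hp a b).continuous

theorem CondC.aestronglyMeasurable_comp (hC : S.CondC γ₂)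
    {x : EuclideanSpace ℝ (Fin k) → EuclideanSpace ℝ (Fin n)}
    (hx : AEStronglyMeasurable x S.μE) :
    AEStronglyMeasurable (fun p => S.K₂ p.1 p.2 (x p.2)) S.μEE := by
  refine aestronglyMeasurable_comp_of_continuous 
    (h := fun p : EuclideanSpace ℝ (Fin k) × EuclideanSpace ℝ (Fin k) => S.K₂ p.1 p.2)
    (x := fun p => x p.2) hC.measurable ?_ hx.comp_snd
  filter_upwards [hC.lipschitz] with p hp
  exact (LipschitzWith.of_dist_le' (K := γ₂ p) fun a b => by
    simpa [dist_eq_norm] using hp a b).continuous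

theorem CondA.ae_norm_sub_le (hA : S.CondA γ₀) : ∀ᵐ ξ ∂S.μE, ∀ x₁ x₂,
    ‖S.f ξ x₁ - S.f ξ x₂‖ ≤ S.kappa₀ γ₀ * ‖x₁ - x₂‖ := by
  filter_upwards [hA.lipschitz, ae_le_toReal_eLpNorm_top hA.gamma_mem] with ξ h1 h2 x₁ x₂
  exact (h1 x₁ x₂).trans (mul_le_mul_of_nonneg_right h2 (norm_nonneg _))

theorem CondC.ae_norm_sub_le (hC : S.CondC γ₂) : ∀ᵐ p ∂S.μEE, ∀ x₁ x₂,
    ‖S.K₂ p.1 p.2 x₁ - S.K₂ p.1 p.2 x₂‖ ≤ S.kappa₂ γ₂ * ‖x₁ - x₂‖ := by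
  filter_upwards [hC.lipschitz, ae_le_toReal_eLpNorm_top hC.gamma_mem] with ξ h1 h2 x₁ x₂
  exact (h1 x₁ x₂).trans (mul_le_mul_of_nonneg_right h2 (norm_nonneg _))

theorem CondA.memLp_comp (hA : S.CondA γ₀) (x : S.StateSpace) :
    MemLp (fun ξ => S.f ξ (x ξ)) 2 S.μE := by
  refine memLp_of_norm_sub_le (hA.aestronglyMeasurable_comp (Lp.aestronglyMeasurable x))
    hA.zero_mem (Lp.memLp x) (c := S.kappa₀ γ₀) ?_
  filter_upwards [hA.ae_norm_sub_le] with ξ hξ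
  exact (hξ (x ξ) 0).trans_eq (by rw [sub_zero])

theorem CondC.memLp_comp [IsFiniteMeasure S.μE] (hC : S.CondC γ₂) (x : S.StateSpace) :
    MemLp (fun p => S.K₂ p.1 p.2 (x p.2)) 2 S.μEE := by
  have hx : MemLp (fun p : EuclideanSpace ℝ (Fin k) × EuclideanSpace ℝ (Fin k) => x p.2) 2 S.μEE :=
    (Lp.memLp x).comp_snd S.μE
  refine memLp_of_norm_sub_le (hC.aestronglyMeasurable_comp (Lp.aestronglyMeasurable x))
    hC.zero_mem hx (c := S.kappa₂ γ₂) ?_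
  filter_upwards [hC.ae_norm_sub_le] with p hp
  exact (hp (x p.2) 0).trans_eq (by rw [sub_zero])

/-- The operator `x ↦ f(·, x(·))` on `L₂(E; ℝⁿ)`. -/
noncomputable def superposition (hA : S.CondA γ₀) (x : S.StateSpace) : S.StateSpace :=
  (hA.memLp_comp x).toLp _

theorem norm_superposition_sub_le (hA : S.CondA γ₀) (x y : S.StateSpace) :
    ‖superposition hA x - superposition hA y‖ ≤ S.kappa₀ γ₀ * ‖x - y‖ := by
  refine Lp.norm_le_mul_norm_of_ae_le_mul ?_
  filter_upwards [Lp.coeFn_sub (superposition hA x) (superposition hA y), Lp.coeFn_sub x y,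
    (hA.memLp_comp x).coeFn_toLp, (hA.memLp_comp y).coeFn_toLp, hA.ae_norm_sub_le]
    with ξ h1 h2 h3 h4 h5
  rw [h1, h2, Pi.sub_apply, Pi.sub_apply, superposition, superposition, h3, h4]
  exact h5 _ _

theorem toReal_eLpNorm_sub (x y : S.StateSpace) :
    (eLpNorm (fun s => x s - y s) 2 S.μE).toReal = ‖x - y‖ := by
  rw [Lp.norm_def]
  exact congrArg _ (eLpNorm_congr_ae (Lp.coeFn_sub x y).symm)

theorem memLp_sub (x y : S.StateSpace) : MemLp (fun s => x s - y s) 2 S.μE :=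
  (Lp.memLp x).sub (Lp.memLp y)

end Nemytskii

section Operators

variable [IsFiniteMeasure S.μE]

theorem CondB.integral_memLp (hB : S.CondB γ₁) (x : S.StateSpace) :
    (∀ᵐ ξ ∂S.μE, Integrable (fun s => S.K₁ ξ s (x s)) S.μE) ∧
      MemLp (fun ξ => ∫ s, S.K₁ ξ s (x s) ∂S.μE) 2 S.μE := by
  have hJ : AEStronglyMeasurable (fun p => S.K₁ p.1 p.2 (x p.2) - S.K₁ p.1 p.2 0) S.μEE :=
    (hB.aestronglyMeasurable_comp (Lp.aestronglyMeasurable x)).sub hB.zero_mem.1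
  have hle : ∀ᵐ p ∂S.μEE, ‖S.K₁ p.1 p.2 (x p.2) - S.K₁ p.1 p.2 0‖ ≤ ‖γ₁ p‖ * ‖x p.2‖ := by
    filter_upwards [hB.lipschitz] with p hp
    have := hp (x p.2) 0
    rw [sub_zero] at this
    exact this.trans (mul_le_mul_of_nonneg_right (le_abs_self _) (norm_nonneg _))
  obtain ⟨hi, hm, -⟩ := integral_kernel_dominated hB.gamma_mem (Lp.memLp x) hJ hle
  -- The part `K₁(ξ, s, 0)` is its own kernel with weight `1`, which is square integrable because
  -- `E` has finite measure.
  obtain ⟨hi', hm', -⟩ := integral_kernel_dominated (w := fun _ => (1 : ℝ)) hB.zero_mem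
    (memLp_const 1) hB.zero_mem.1 (by simp)
  have hint : ∀ᵐ ξ ∂S.μE, Integrable (fun s => S.K₁ ξ s (x s)) S.μE := by
    filter_upwards [hi, hi'] with ξ h h'
    exact (h.add h').congr (Eventually.of_forall fun _ => sub_add_cancel _ _)
  refine ⟨hint, (hm.add hm').ae_eq ?_⟩
  filter_upwards [hi, hi'] with ξ h h'
  simp only [Pi.add_apply]
  rw [← integral_add h h']
  simp

theorem CondC.aestronglyMeasurable_apply (hC : S.CondC γ₂) (u : S.ControlSpace)
    (x : S.StateSpace) :
    AEStronglyMeasurable (fun p => S.K₂ p.1 p.2 (x p.2) (u p.2)) S.μEE :=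
  isBoundedBilinearMap_apply.continuous.comp_aestronglyMeasurable
    ((hC.memLp_comp x).1.prodMk (Lp.aestronglyMeasurable u).comp_snd)

theorem CondC.integral_memLp (hC : S.CondC γ₂) (u : S.ControlSpace) (x : S.StateSpace) :
    (∀ᵐ ξ ∂S.μE, Integrable (fun s => S.K₂ ξ s (x s) (u s)) S.μE) ∧
      MemLp (fun ξ => ∫ s, S.K₂ ξ s (x s) (u s) ∂S.μE) 2 S.μE := by
  have h := integral_kernel_dominated (J := fun p => S.K₂ p.1 p.2 (x p.2) (u p.2))
    (hC.memLp_comp x) (Lp.memLp u)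
    (hC.aestronglyMeasurable_apply u x)
    (Eventually.of_forall fun p => ContinuousLinearMap.le_opNorm _ _)
  exact ⟨h.1, h.2.1⟩

/-- The operator `x ↦ ∫ K₁(·, s, x(s)) ds` on `L₂(E; ℝⁿ)`. -/
noncomputable def freeOp (hB : S.CondB γ₁) (x : S.StateSpace) : S.StateSpace :=
  (hB.integral_memLp x).2.toLp _

/-- The operator `(u, x) ↦ ∫ K₂(·, s, x(s)) u(s) ds`. -/
noncomputable def controlOp (hC : S.CondC γ₂) (u : S.ControlSpace) (x : S.StateSpace) : S.StateSpace :=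
  (hC.integral_memLp u x).2.toLp _

/-- The right-hand side of the state equation as an operator on `L₂(E; ℝⁿ)`. -/
noncomputable def stateOp (hA : S.CondA γ₀) (hB : S.CondB γ₁) (hC : S.CondC γ₂)
    (u : S.ControlSpace) (x : S.StateSpace) : S.StateSpace :=
  superposition hA x + S.lam • (freeOp hB x + controlOp hC u x)

theorem coeFn_controlOp (hC : S.CondC γ₂) (u : S.ControlSpace) (x : S.StateSpace) :
    controlOp hC u x =ᵐ[S.μE] fun ξ => ∫ s, S.K₂ ξ s (x s) (u s) ∂S.μE :=
  MemLp.coeFn_toLp _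

/-- Makes the contraction principle applicable. The integrability clause holds for every pair `(u,
x)`, so only the equation remains. -/
theorem isTrajectory_iff (hA : S.CondA γ₀) (hB : S.CondB γ₁) (hC : S.CondC γ₂)
    (u : S.ControlSpace) (x : S.StateSpace) :
    S.IsTrajectory u x ↔ stateOp hA hB hC u x = x := by
  have hcoe : stateOp hA hB hC u x =ᵐ[S.μE] fun ξ => S.f ξ (x ξ) +
      S.lam • ∫ s in S.E, (S.K₁ ξ s (x s) + S.K₂ ξ s (x s) (u s)) := by
    filter_upwards [Lp.coeFn_add (superposition hA x) (S.lam • (freeOp hB x + controlOp hC u x)),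
      Lp.coeFn_smul S.lam (freeOp hB x + controlOp hC u x),
      Lp.coeFn_add (freeOp hB x) (controlOp hC u x),
      (hA.memLp_comp x).coeFn_toLp, (hB.integral_memLp x).2.coeFn_toLp,
      coeFn_controlOp hC u x, (hB.integral_memLp x).1, (hC.integral_memLp u x).1]
      with ξ h1 h2 h3 h4 h5 h6 h7 h8
    rw [integral_add h7 h8, ← h5, ← h6, ← h4, stateOp, h1, Pi.add_apply, h2, Pi.smul_apply, h3,
      Pi.add_apply]
    rfl
  constructor
  · intro h
    refine Lp.ext ?_
    filter_upwards [hcoe, h] with ξ h1 h2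
    rw [h1, ← h2.2]
  · intro h
    rw [h] at hcoe
    filter_upwards [hcoe, (hB.integral_memLp x).1, (hC.integral_memLp u x).1] with ξ h1 h2 h3
    exact ⟨h2.add h3, h1⟩

theorem coeFn_freeOp (hB : S.CondB γ₁) (x : S.StateSpace) :
    freeOp hB x =ᵐ[S.μE] fun ξ => ∫ s, S.K₁ ξ s (x s) ∂S.μE :=
  MemLp.coeFn_toLp _

theorem norm_freeOp_sub_le (hB : S.CondB γ₁) (x y : S.StateSpace) :
    ‖freeOp hB x - freeOp hB y‖ ≤ S.kappa₁ γ₁ * ‖x - y‖ := by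
  rw [← toReal_eLpNorm_sub x y]
  refine Lp.norm_sub_le_of_kernel_dominated (J₁ := fun p => S.K₁ p.1 p.2 (x p.2))
    (J₂ := fun p => S.K₁ p.1 p.2 (y p.2)) hB.gamma_mem (memLp_sub x y)
    (hB.aestronglyMeasurable_comp (Lp.aestronglyMeasurable x))
    (hB.aestronglyMeasurable_comp (Lp.aestronglyMeasurable y))
    (hB.integral_memLp x).1 (hB.integral_memLp y).1 (coeFn_freeOp hB x) (coeFn_freeOp hB y) ?_
  filter_upwards [hB.lipschitz] with p hp
  exact (hp _ _).trans (mul_le_mul_of_nonneg_right (le_abs_self _) (norm_nonneg _))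

/-- The control is treated as part of the kernel: `κ₂ • u(s)`, constant in `ξ`, has `L₂(E × E)` norm
`κ₂ ‖u‖ √μ(E)`, while `x - y` is the weight. -/
theorem norm_controlOp_sub_le (hC : S.CondC γ₂) (u : S.ControlSpace) (x y : S.StateSpace) :
    ‖controlOp hC u x - controlOp hC u y‖ ≤
      S.kappa₂ γ₂ * ‖u‖ * Real.sqrt (volume.real S.E) * ‖x - y‖ := by
  have huc : MemLp (fun p : EuclideanSpace ℝ (Fin k) × EuclideanSpace ℝ (Fin k) =>
      S.kappa₂ γ₂ • u p.2) 2 S.μEE :=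
    ((Lp.memLp u).const_smul (S.kappa₂ γ₂)).comp_snd S.μE
  have hκ : (eLpNorm (fun p : EuclideanSpace ℝ (Fin k) × EuclideanSpace ℝ (Fin k) =>
      S.kappa₂ γ₂ • u p.2) 2 S.μEE).toReal =
      S.kappa₂ γ₂ * ‖u‖ * Real.sqrt (volume.real S.E) := by
    have h := eLpNorm_const_smul (S.kappa₂ γ₂)
      (fun p : EuclideanSpace ℝ (Fin k) × EuclideanSpace ℝ (Fin k) => u p.2) 2 S.μEE
    have h' : 0 ≤ S.kappa₂ γ₂ := ENNReal.toReal_nonneg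
    have hE' : S.μE.real univ = volume.real S.E := by simp
    rw [← hE', mul_assoc, Lp.norm_def, ← toReal_eLpNorm_two_comp_snd (μ := S.μE) (Lp.memLp u)]
    refine (congrArg ENNReal.toReal h).trans ?_
    rw [ENNReal.toReal_mul, toReal_enorm, Real.norm_of_nonneg h']
  rw [← hκ, ← toReal_eLpNorm_sub x y]
  refine Lp.norm_sub_le_of_kernel_dominated (J₁ := fun p => S.K₂ p.1 p.2 (x p.2) (u p.2))
    (J₂ := fun p => S.K₂ p.1 p.2 (y p.2) (u p.2)) huc (memLp_sub x y)
    (hC.aestronglyMeasurable_apply u x) (hC.aestronglyMeasurable_apply u y)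
    (hC.integral_memLp u x).1 (hC.integral_memLp u y).1
    (coeFn_controlOp hC u x) (coeFn_controlOp hC u y) ?_
  filter_upwards [hC.ae_norm_sub_le] with p hp
  have h' : 0 ≤ S.kappa₂ γ₂ := ENNReal.toReal_nonneg
  rw [← _root_.sub_apply, norm_smul, Real.norm_of_nonneg h']
  refine (ContinuousLinearMap.le_opNorm _ _).trans ?_
  refine (mul_le_mul_of_nonneg_right (hp _ _) (norm_nonneg _)).trans_eq ?_
  ring

/-- Weak convergence of controls gives strong convergence of the control term. -/
theorem tendsto_controlOp_of_weak (hC : S.CondC γ₂) {ρ : ℝ} (x : S.StateSpace)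
    {u : ℕ → S.ControlSpace} {u₀ : S.ControlSpace} (hb : ∀ j, ‖u j‖ ≤ ρ)
    (hu : ∀ w : S.ControlSpace, Tendsto (fun j => inner ℝ w (u j)) atTop (𝓝 (inner ℝ w u₀))) :
    Tendsto (fun j => controlOp hC (u j) x) atTop (𝓝 (controlOp hC u₀ x)) := by
  rw [Lp.tendsto_Lp_iff_tendsto_eLpNorm']
  have hk := hC.memLp_comp x
  -- For almost every `ξ` the slice of the kernel is in `L₂`, so weak convergence gives pointwise
  -- convergence; Cauchy–Schwarz and the bound on the controls give the majorant.
  refine tendsto_eLpNorm_two_of_dominated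
    (b := fun ξ => eLpNorm (fun s => S.K₂ ξ s (x s)) 2 S.μE * ENNReal.ofReal (ρ + ‖u₀‖))
    (fun j => (Lp.aestronglyMeasurable _).sub (Lp.aestronglyMeasurable _)) ?_ (fun j => ?_) ?_
  · simp_rw [mul_pow]
    rw [lintegral_mul_const' _ _ (by simp), lintegral_eLpNorm_two_sq_prod hk.1]
    exact ENNReal.mul_ne_top (ENNReal.pow_ne_top hk.2.ne) (by simp)
  · filter_upwards [coeFn_controlOp hC (u j) x, coeFn_controlOp hC u₀ x,
      (hC.integral_memLp (u j) x).1, (hC.integral_memLp u₀ x).1, hk.1.prodMk_left]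
      with ξ h1 h2 h3 h4 h5
    have hmeas : AEStronglyMeasurable (fun s => u j s - u₀ s) S.μE :=
      (Lp.aestronglyMeasurable _).sub (Lp.aestronglyMeasurable _)
    have hnorm : eLpNorm (fun s => u j s - u₀ s) 2 S.μE ≤ ENNReal.ofReal (ρ + ‖u₀‖) := by
      refine (eLpNorm_congr_ae (Lp.coeFn_sub (u j) u₀)).symm.trans_le ?_
      rw [← ENNReal.ofReal_toReal (Lp.eLpNorm_ne_top (u j - u₀)), ← Lp.norm_def]
      exact ENNReal.ofReal_le_ofReal ((norm_sub_le _ _).trans (by gcongr; exact hb j))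
    rw [Pi.sub_apply, h1, h2, ← integral_sub h3 h4]
    refine (enorm_integral_le_lintegral_enorm _).trans ?_
    refine le_trans ?_ ((lintegral_enorm_mul_le_eLpNorm_two h5 hmeas).trans (by gcongr))
    refine lintegral_mono fun s => ?_
    rw [← map_sub]
    exact ContinuousLinearMap.le_opENorm _ _
  · have hall : ∀ᵐ ξ ∂S.μE, ∀ j, controlOp hC (u j) x ξ =
        ∫ s, S.K₂ ξ s (x s) (u j s) ∂S.μE :=
      ae_all_iff.mpr fun j => coeFn_controlOp hC (u j) x
    filter_upwards [hall, coeFn_controlOp hC u₀ x, ae_memLp_two_of_prod hk] with ξ h1 h2 h3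
    simp only [Pi.sub_apply, h1, h2]
    have := (tendsto_integral_clm_apply_of_weak h3 hu).sub_const
      (∫ s, S.K₂ ξ s (x s) (u₀ s) ∂S.μE)
    rwa [sub_self] at this

end Operators

end UrysohnSystem

/-! ### Weak compactness of controls and compactness of the trajectory set. -/

/-- In a separable Hilbert space every bounded sequence has a weakly convergent subsequence. -/
theorem exists_weak_limit_subseq {H : Type*} [NormedAddCommGroup H] [InnerProductSpace ℝ H]
    [CompleteSpace H] [TopologicalSpace.SeparableSpace H] {ρ : ℝ} {u : ℕ → H}
    (hu : ∀ j, ‖u j‖ ≤ ρ) : ∃ u₀ : H, ‖u₀‖ ≤ ρ ∧ ∃ φ : ℕ → ℕ, StrictMono φ ∧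
      ∀ w : H, Tendsto (fun j => inner ℝ w (u (φ j))) atTop (𝓝 (inner ℝ w u₀)) := by
  -- Sequential Banach–Alaoglu in the dual, carried to `H` by the Riesz isometry.
  obtain ⟨ℓ, hℓ, φ, hφ, hlim⟩ := WeakDual.isSeqCompact_closedBall ℝ H 0 ρ
    (x := fun j => StrongDual.toWeakDual (InnerProductSpace.toDual ℝ H (u j)))
    (fun j => by simpa using hu j)
  obtain ⟨u₀, hu₀⟩ := (InnerProductSpace.toDual ℝ H).surjective (WeakDual.toStrongDual ℓ)
  refine ⟨u₀, ?_, φ, hφ, fun w => ?_⟩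
  · have : ‖WeakDual.toStrongDual ℓ‖ ≤ ρ := by simpa using hℓ
    rwa [← hu₀, LinearIsometryEquiv.norm_map] at this
  · have h := ((WeakDual.eval_continuous w).tendsto ℓ).comp hlim
    have hℓw : ℓ w = inner ℝ w u₀ := by
      rw [real_inner_comm, ← InnerProductSpace.toDual_apply_apply, hu₀]
      rfl
    rw [hℓw] at h
    refine h.congr fun j => ?_
    rw [real_inner_comm]
    rfl

namespace UrysohnSystem

variable {k n m : ℕ} {S : UrysohnSystem k n m} {γ₀ : EuclideanSpace ℝ (Fin k) → ℝ}
  {γ₁ γ₂ : EuclideanSpace ℝ (Fin k) × EuclideanSpace ℝ (Fin k) → ℝ}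

/-- The Lipschitz constant of the state operator for controls of norm at most `ρ`. -/
noncomputable def contractionConst (S : UrysohnSystem k n m) (ρ κ₀ κ₁ κ₂ : ℝ) : ℝ :=
  κ₀ + S.lam * (κ₁ + κ₂ * ρ * Real.sqrt (volume.real S.E))

/-- The constant is a sum of three terms whose squares add up to less than `1/6`; since `(a + b +
c)² ≤ 3 (a² + b² + c²) < 1/2`, the sum is below `1`. -/
theorem contractionConst_lt_one {ρ κ₀ κ₁ κ₂ : ℝ} (hD : S.CondD ρ κ₀ κ₁ κ₂) :
    S.contractionConst ρ κ₀ κ₁ κ₂ < 1 := by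
  have hs : Real.sqrt (volume.real S.E) ^ 2 = volume.real S.E := Real.sq_sqrt measureReal_nonneg
  unfold CondD at hD
  unfold contractionConst
  rw [← hs] at hD
  generalize Real.sqrt (volume.real S.E) = s at hD
  nlinarith [sq_nonneg (κ₀ - S.lam * κ₁), sq_nonneg (κ₀ - S.lam * ρ * κ₂ * s),
    sq_nonneg (S.lam * κ₁ - S.lam * ρ * κ₂ * s),
    sq_nonneg (κ₀ + S.lam * κ₁ + S.lam * ρ * κ₂ * s - 1)]

variable [IsFiniteMeasure S.μE]

theorem norm_stateOp_sub_le (hA : S.CondA γ₀) (hB : S.CondB γ₁) (hC : S.CondC γ₂)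
    (hlam : 0 ≤ S.lam) {ρ : ℝ} {u : S.ControlSpace} (hu : ‖u‖ ≤ ρ) (x y : S.StateSpace) :
    ‖stateOp hA hB hC u x - stateOp hA hB hC u y‖ ≤
      S.contractionConst ρ (S.kappa₀ γ₀) (S.kappa₁ γ₁) (S.kappa₂ γ₂) * ‖x - y‖ := by
  have hκ₂ : 0 ≤ S.kappa₂ γ₂ := ENNReal.toReal_nonneg
  have heq : stateOp hA hB hC u x - stateOp hA hB hC u y =
      (superposition hA x - superposition hA y) +
        S.lam • ((freeOp hB x - freeOp hB y) + (controlOp hC u x - controlOp hC u y)) := by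
    simp only [stateOp]
    module
  rw [heq]
  refine (norm_add_le _ _).trans ?_
  rw [norm_smul, Real.norm_of_nonneg hlam]
  have h1 := norm_superposition_sub_le hA x y
  have h2 := (norm_add_le _ _).trans
    (add_le_add (norm_freeOp_sub_le hB x y) (norm_controlOp_sub_le hC u x y))
  have h3 : S.kappa₂ γ₂ * ‖u‖ * Real.sqrt (volume.real S.E) * ‖x - y‖ ≤
      S.kappa₂ γ₂ * ρ * Real.sqrt (volume.real S.E) * ‖x - y‖ := by gcongr
  calc _ ≤ S.kappa₀ γ₀ * ‖x - y‖ + S.lam * (S.kappa₁ γ₁ * ‖x - y‖ +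
        S.kappa₂ γ₂ * ρ * Real.sqrt (volume.real S.E) * ‖x - y‖) :=
        add_le_add h1 (mul_le_mul_of_nonneg_left (h2.trans (by gcongr)) hlam)
    _ = _ := by unfold contractionConst; ring

theorem existsUnique_isTrajectory (hA : S.CondA γ₀) (hB : S.CondB γ₁) (hC : S.CondC γ₂)
    (hlam : 0 ≤ S.lam) {ρ : ℝ} (hD : S.CondD ρ (S.kappa₀ γ₀) (S.kappa₁ γ₁) (S.kappa₂ γ₂))
    {u : S.ControlSpace} (hu : ‖u‖ ≤ ρ) : ∃! x, S.IsTrajectory u x := by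
  have hlip : LipschitzWith
      (S.contractionConst ρ (S.kappa₀ γ₀) (S.kappa₁ γ₁) (S.kappa₂ γ₂)).toNNReal
      (stateOp hA hB hC u) :=
    LipschitzWith.of_dist_le' fun x y => by
      simpa only [dist_eq_norm] using norm_stateOp_sub_le hA hB hC hlam hu x y
  have hcontr : ContractingWith
      (S.contractionConst ρ (S.kappa₀ γ₀) (S.kappa₁ γ₁) (S.kappa₂ γ₂)).toNNReal
      (stateOp hA hB hC u) :=
    ⟨by simpa using contractionConst_lt_one hD, hlip⟩
  simp_rw [isTrajectory_iff hA hB hC]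
  exact ⟨hcontr.fixedPoint _, hcontr.fixedPoint_isFixedPt,
    fun y hy => hcontr.fixedPoint_unique hy⟩

/-- The trajectories depend continuously on the controls, from the weak to the norm topology. -/
theorem tendsto_trajectory_of_weak (hA : S.CondA γ₀) (hB : S.CondB γ₁) (hC : S.CondC γ₂)
    (hlam : 0 ≤ S.lam) {ρ : ℝ} (hD : S.CondD ρ (S.kappa₀ γ₀) (S.kappa₁ γ₁) (S.kappa₂ γ₂))
    {u : ℕ → S.ControlSpace} {u₀ : S.ControlSpace} (hb : ∀ j, ‖u j‖ ≤ ρ)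
    (hu : ∀ w : S.ControlSpace, Tendsto (fun j => inner ℝ w (u j)) atTop (𝓝 (inner ℝ w u₀)))
    {x : ℕ → S.StateSpace} {x₀ : S.StateSpace} (hx : ∀ j, S.IsTrajectory (u j) (x j))
    (hx₀ : S.IsTrajectory u₀ x₀) : Tendsto x atTop (𝓝 x₀) := by
  simp_rw [isTrajectory_iff hA hB hC] at hx hx₀
  have hlim := tendsto_iff_norm_sub_tendsto_zero.mp (tendsto_controlOp_of_weak hC x₀ hb hu)
  rw [tendsto_iff_norm_sub_tendsto_zero]
  have hq := contractionConst_lt_one hD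
  set q := S.contractionConst ρ (S.kappa₀ γ₀) (S.kappa₁ γ₁) (S.kappa₂ γ₂) with hqdef
  -- The contraction absorbs the change of state, so the control terms need comparing only at the
  -- fixed state `x₀`, where weak convergence suffices.
  have hbound : ∀ j, ‖x j - x₀‖ ≤
      (1 - q)⁻¹ * (S.lam * ‖controlOp hC (u j) x₀ - controlOp hC u₀ x₀‖) := by
    intro j
    have h1 := norm_stateOp_sub_le hA hB hC hlam (hb j) (x j) x₀
    have heq : x j - x₀ = (stateOp hA hB hC (u j) (x j) - stateOp hA hB hC (u j) x₀) +
        S.lam • (controlOp hC (u j) x₀ - controlOp hC u₀ x₀) := by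
      have h2 : stateOp hA hB hC (u j) x₀ - stateOp hA hB hC u₀ x₀ =
          S.lam • (controlOp hC (u j) x₀ - controlOp hC u₀ x₀) := by
        simp only [stateOp]
        module
      rw [← h2, hx, hx₀]
      abel
    have h3 : ‖x j - x₀‖ ≤ q * ‖x j - x₀‖ +
        S.lam * ‖controlOp hC (u j) x₀ - controlOp hC u₀ x₀‖ := by
      conv_lhs => rw [heq]
      refine (norm_add_le _ _).trans ?_
      rw [norm_smul, Real.norm_of_nonneg hlam]
      exact add_le_add h1 le_rfl
    rw [inv_mul_eq_div, le_div_iff₀ (by linarith)]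
    linarith
  refine squeeze_zero (fun j => norm_nonneg _) hbound ?_
  simpa using (hlim.const_mul S.lam).const_mul (1 - q)⁻¹

/-- A weak limit of admissible controls is admissible, and the trajectories converge in norm to the
one it generates. -/
theorem isSeqCompact_Z (hA : S.CondA γ₀) (hB : S.CondB γ₁) (hC : S.CondC γ₂)
    (hlam : 0 ≤ S.lam) {ρ : ℝ} (hD : S.CondD ρ (S.kappa₀ γ₀) (S.kappa₁ γ₁) (S.kappa₂ γ₂)) :
    IsSeqCompact (S.Z ρ) := by
  intro x hx
  choose u hu hux using hx
  have : Fact ((2 : ℝ≥0∞) ≠ ∞) := ⟨by norm_num⟩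
  have : TopologicalSpace.SeparableSpace S.ControlSpace :=
    TopologicalSpace.SecondCountableTopology.to_separableSpace
  obtain ⟨u₀, hu₀, φ, hφ, hw⟩ := exists_weak_limit_subseq hu
  obtain ⟨x₀, hx₀, -⟩ := existsUnique_isTrajectory hA hB hC hlam hD hu₀
  exact ⟨x₀, ⟨u₀, hu₀, hx₀⟩, φ, hφ, tendsto_trajectory_of_weak hA hB hC hlam hD
    (fun j => hu (φ j)) hw (fun j => hux (φ j)) hx₀⟩

/-- Norm continuity of the trajectory as a function of the control. -/
theorem exists_norm_trajectory_sub_le (hA : S.CondA γ₀) (hB : S.CondB γ₁) (hC : S.CondC γ₂)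
    (hlam : 0 ≤ S.lam) {ρ : ℝ} (hD : S.CondD ρ (S.kappa₀ γ₀) (S.kappa₁ γ₁) (S.kappa₂ γ₂))
    {u₀ : S.ControlSpace} {x₀ : S.StateSpace} (hx₀ : S.IsTrajectory u₀ x₀)
    {ε : ℝ} (hε : 0 < ε) : ∃ η > 0, ∀ u : S.ControlSpace, ‖u‖ ≤ ρ → ‖u - u₀‖ ≤ η →
      ∀ x, S.IsTrajectory u x → ‖x - x₀‖ ≤ ε := by
  by_contra! hcon
  choose u hu hun x hx hxn using fun j : ℕ => hcon (1 / ((j : ℝ) + 1)) (by positivity)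
  have hlim : Tendsto u atTop (𝓝 u₀) := by
    rw [tendsto_iff_norm_sub_tendsto_zero]
    exact squeeze_zero (fun j => norm_nonneg _) hun tendsto_one_div_add_atTop_nhds_zero_nat
  have hxlim := tendsto_trajectory_of_weak hA hB hC hlam hD hu
    (fun w => tendsto_const_nhds.inner hlim) hx hx₀
  rw [tendsto_iff_norm_sub_tendsto_zero] at hxlim
  obtain ⟨j, hj⟩ := (hxlim.eventually_lt_const hε).exists
  exact (hxn j).not_gt hj

end UrysohnSystem

/-! ### Discrete controls and their density in the ball. -/

namespace IsUniformPartition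

variable {q : ℕ} {α δ : ℝ} {r : Fin (q + 1) → ℝ}

theorem apply_eq (h : IsUniformPartition α δ r) (i : ℕ) (hi : i < q + 1) :
    r ⟨i, hi⟩ = i * δ := by
  induction i with
  | zero => simpa using h.first
  | succ i ih =>
    have h1 := h.step ⟨i, by omega⟩
    have h2 := ih (by omega)
    simp only [Fin.succ_mk, Fin.castSucc_mk] at h1
    push_cast
    linarith

theorem exists_abs_sub_le (h : IsUniformPartition α δ r) (hδ : 0 < δ) {t : ℝ} (ht₀ : 0 ≤ t)
    (ht : t ≤ α) : ∃ j, |r j - t| ≤ δ := by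
  have hα : (q : ℝ) * δ = α := by rw [← h.last, ← h.apply_eq q (by omega)]; rfl
  have hdiv : t / δ ≤ q := by rw [div_le_iff₀ hδ]; linarith
  have hfloor : ⌊t / δ⌋₊ ≤ q := by
    simpa using Nat.floor_le_floor hdiv
  -- Rounding down to the grid; the index does not exceed `q` because `q δ = α`.
  refine ⟨⟨⌊t / δ⌋₊, by omega⟩, ?_⟩
  rw [h.apply_eq, abs_le]
  have h1 : (⌊t / δ⌋₊ : ℝ) * δ ≤ t := by
    rw [← le_div_iff₀ hδ]
    exact Nat.floor_le (by positivity)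
  have h2 : t < (⌊t / δ⌋₊ + 1) * δ := by
    rw [← div_lt_iff₀ hδ]
    exact Nat.lt_floor_add_one _
  constructor <;> linarith

end IsUniformPartition

/-- Every vector of norm at most `α` is close to a multiple `r j • b` of a vector of the net. -/
theorem exists_smul_sphereNet_near {m q : ℕ} (hm : 1 ≤ m) {α δ σ : ℝ} {r : Fin (q + 1) → ℝ}
    (hr : IsUniformPartition α δ r) (hδ : 0 < δ) {B : Finset (EuclideanSpace ℝ (Fin m))}
    (hB : IsSphereNet σ B) {c : EuclideanSpace ℝ (Fin m)} (hc : ‖c‖ ≤ α) :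
    ∃ j, ∃ b ∈ B, ‖r j • b - c‖ ≤ δ + ‖c‖ * σ := by
  obtain ⟨e, he, hce⟩ : ∃ e : EuclideanSpace ℝ (Fin m), ‖e‖ = 1 ∧ c = ‖c‖ • e := by
    by_cases h0 : c = 0
    · exact ⟨EuclideanSpace.single ⟨0, hm⟩ 1, by simp, by simp [h0]⟩
    · have hn : ‖c‖ ≠ 0 := norm_ne_zero_iff.mpr h0
      exact ⟨‖c‖⁻¹ • c, by rw [norm_smul, norm_inv, norm_norm, inv_mul_cancel₀ hn],
        by rw [smul_inv_smul₀ hn]⟩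
  obtain ⟨b, hb, heb⟩ := hB.cover e he
  obtain ⟨j, hj⟩ := hr.exists_abs_sub_le hδ (norm_nonneg c) hc
  refine ⟨j, b, hb, ?_⟩
  have hsplit : r j • b - c = (r j - ‖c‖) • b + ‖c‖ • (b - e) := by
    conv_lhs => rw [hce]
    module
  rw [hsplit]
  refine (norm_add_le _ _).trans ?_
  rw [norm_smul, norm_smul, hB.norm_eq b hb, mul_one, norm_norm, norm_sub_rev b e]
  exact add_le_add hj (by gcongr)

namespace UrysohnSystem

variable {k n m N q : ℕ} {S : UrysohnSystem k n m}
  {Γ : Fin N → Set (EuclideanSpace ℝ (Fin k))} {Δ : ℝ}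

/-- Identifies the sum constraint on discrete controls with `‖u‖ ≤ ρ`; needed both for admissibility
and to check the constraint for a constructed control. -/
theorem norm_sq_eq_of_piecewise_const (hE : IsCompact S.E) (hΓ : IsDeltaPartition S.E Δ Γ)
    {u : S.ControlSpace} {c : Fin N → EuclideanSpace ℝ (Fin m)}
    (hu : ∀ i, ∀ᵐ s ∂S.μE, s ∈ Γ i → u s = c i) :
    ‖u‖ ^ 2 = ∑ i, volume.real (Γ i) * ‖c i‖ ^ 2 := by
  have := isFiniteMeasure_μE hE
  have hnull : ∀ i, NullMeasurableSet (Γ i) S.μE := fun i =>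
    (hΓ.measurable i).mono Measure.restrict_le_self
  have hae : (fun s => inner ℝ (u s) (u s)) =ᵐ[S.μE]
      fun s => ∑ i, (Γ i).indicator (fun _ => ‖c i‖ ^ 2) s := by
    filter_upwards [ae_all_iff.mpr hu, ae_restrict_mem hE.measurableSet] with s hs hsE
    rw [hΓ.union, mem_iUnion] at hsE
    obtain ⟨i, hi⟩ := hsE
    rw [Finset.sum_eq_single i, indicator_of_mem hi, hs i hi, real_inner_self_eq_norm_sq]
    · intro j _ hji
      refine indicator_of_notMem (fun hj => ?_) _
      have : s ∈ Γ j ∩ Γ i := ⟨hj, hi⟩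
      rw [hΓ.disjoint j i hji] at this
      exact this
    · simp
  rw [← real_inner_self_eq_norm_sq, L2.inner_def, integral_congr_ae hae,
    integral_finsetSum _ fun i _ => (integrable_const _).indicator₀ (hnull i)]
  refine Finset.sum_congr rfl fun i _ => ?_
  rw [integral_indicator₀ (hnull i), setIntegral_const, smul_eq_mul, measureReal_def,
    Measure.restrict_eq_self _ (hΓ.subset i), ← measureReal_def]

theorem discreteControls_subset_admissible (hE : IsCompact S.E) (hΓ : IsDeltaPartition S.E Δ Γ)
    {ρ σ : ℝ} (hρ : 0 ≤ ρ) {r : Fin (q + 1) → ℝ} {B : Finset (EuclideanSpace ℝ (Fin m))}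
    (hB : IsSphereNet σ B) : S.discreteControls ρ Γ r B ⊆ S.admissible ρ := by
  rintro u ⟨j, b, hb, hu, hsum⟩
  have hnorm := norm_sq_eq_of_piecewise_const hE hΓ hu
  simp_rw [norm_smul, hB.norm_eq _ (hb _), mul_one, Real.norm_eq_abs, sq_abs] at hnorm
  exact (sq_le_sq₀ (norm_nonneg u) hρ).mp (hnorm.trans_le hsum)

theorem finite_discreteControls (hE : IsCompact S.E) (hΓ : IsDeltaPartition S.E Δ Γ)
    (ρ : ℝ) (r : Fin (q + 1) → ℝ) (B : Finset (EuclideanSpace ℝ (Fin m))) :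
    (S.discreteControls ρ Γ r B).Finite := by
  have hfin : (⋃ (j : Fin N → Fin (q + 1)) (b : Fin N → B),
      {u : S.ControlSpace | ∀ i, ∀ᵐ s ∂S.μE,
        s ∈ Γ i → u s = r (j i) • (b i : EuclideanSpace ℝ (Fin m))}).Finite := by
    refine finite_iUnion fun j => finite_iUnion fun b => Set.Subsingleton.finite ?_
    intro u hu v hv
    refine Lp.ext ?_
    filter_upwards [ae_all_iff.mpr hu, ae_all_iff.mpr hv, ae_restrict_mem hE.measurableSet]
      with s h1 h2 hsE
    rw [hΓ.union, mem_iUnion] at hsE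
    obtain ⟨i, hi⟩ := hsE
    rw [h1 i hi, h2 i hi]
  refine hfin.subset ?_
  rintro u ⟨j, b, hb, hu, -⟩
  simp only [mem_iUnion]
  exact ⟨j, fun i => ⟨b i, hb i⟩, hu⟩

/-- Existence of a piecewise constant control with prescribed values. -/
theorem exists_piecewise_const (hE : IsCompact S.E) (hΓ : IsDeltaPartition S.E Δ Γ)
    (c : Fin N → EuclideanSpace ℝ (Fin m)) :
    ∃ v : S.ControlSpace, ∀ i, ∀ᵐ s ∂S.μE, s ∈ Γ i → v s = c i := by
  have := isFiniteMeasure_μE hE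
  have hnull : ∀ i, NullMeasurableSet (Γ i) S.μE := fun i =>
    (hΓ.measurable i).mono Measure.restrict_le_self
  have hmem : MemLp (fun s => ∑ i, (Γ i).indicator (fun _ => c i) s) 2 S.μE := by
    refine memLp_finsetSum _ fun i _ => ?_
    refine MemLp.of_bound (aestronglyMeasurable_const.indicator₀ (hnull i)) ‖c i‖
      (Eventually.of_forall fun s => norm_indicator_le_norm_self _ _)
  refine ⟨hmem.toLp _, fun i => ?_⟩
  filter_upwards [hmem.coeFn_toLp] with s hs hi
  rw [hs, Finset.sum_eq_single i, indicator_of_mem hi]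
  · intro j _ hji
    refine indicator_of_notMem (fun hj => ?_) _
    have : s ∈ Γ j ∩ Γ i := ⟨hj, hi⟩
    rw [hΓ.disjoint j i hji] at this
    exact this
  · simp

/-- Discrete controls approximate a given admissible control in norm. -/
theorem exists_discreteControls_near (hm : 1 ≤ m) (hE : IsCompact S.E) {ρ : ℝ} (hρ : 0 < ρ)
    {u : S.ControlSpace} (hu : ‖u‖ ≤ ρ) {η : ℝ} (hη : 0 < η) :
    ∃ M : ℝ, ∀ α, 0 < α → M ≤ α → ∃ τ : ℝ, 0 < τ ∧
      ∀ Δ ≤ τ, ∀ δ ∈ Ioc 0 τ, ∀ σ ≤ τ,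
      ∀ (N : ℕ) (Γ : Fin N → Set (EuclideanSpace ℝ (Fin k))), IsDeltaPartition S.E Δ Γ →
      ∀ (q : ℕ) (r : Fin (q + 1) → ℝ), IsUniformPartition α δ r →
      ∀ B : Finset (EuclideanSpace ℝ (Fin m)), IsSphereNet σ B →
        ∃ v ∈ S.discreteControls ρ Γ r B, ‖v - u‖ ≤ η := by
  have := isFiniteMeasure_μE hE
  -- Keeps the scaling factor `1 - η / (2ρ)` below nonnegative.
  wlog hηρ : η ≤ ρ generalizing η
  · obtain ⟨M, hM⟩ := this hρ le_rfl
    refine ⟨M, fun α hα hMα => ?_⟩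
    obtain ⟨τ, hτ, h⟩ := hM α hα hMα
    refine ⟨τ, hτ, fun Δ hΔ δ hδ σ hσ N Γ hΓ q r hr B hB => ?_⟩
    obtain ⟨v, hv, hvu⟩ := h Δ hΔ δ hδ σ hσ N Γ hΓ q r hr B hB
    exact ⟨v, hv, hvu.trans (not_le.mp hηρ).le⟩
  -- Shrinking `u` leaves room in the ball: anything within `η / 2` of `w` still satisfies the norm
  -- constraint.
  obtain ⟨w, hw, hwu⟩ : ∃ w : S.ControlSpace, ‖w‖ ≤ ρ - η / 2 ∧ ‖w - u‖ ≤ η / 2 := by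
    have h1 : 0 ≤ 1 - η / (2 * ρ) := by
      rw [sub_nonneg, div_le_one (by positivity)]
      linarith
    refine ⟨(1 - η / (2 * ρ)) • u, ?_, ?_⟩
    · rw [norm_smul, Real.norm_of_nonneg h1]
      calc (1 - η / (2 * ρ)) * ‖u‖ ≤ (1 - η / (2 * ρ)) * ρ := by gcongr
        _ = ρ - η / 2 := by field_simp
    · have : (1 - η / (2 * ρ)) • u - u = (-(η / (2 * ρ))) • u := by module
      rw [this, norm_smul, norm_neg, Real.norm_of_nonneg (by positivity)]
      calc η / (2 * ρ) * ‖u‖ ≤ η / (2 * ρ) * ρ := by gcongr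
        _ = η / 2 := by field_simp
  obtain ⟨g, hgs, hgw, hgc, hgm⟩ := (Lp.memLp w).exists_hasCompactSupport_eLpNorm_sub_le
    (by norm_num) (ε := ENNReal.ofReal (η / 4)) (by simpa using hη)
  have hGw : ‖hgm.toLp g - w‖ ≤ η / 4 := by
    have hae : ⇑(w - hgm.toLp g) =ᵐ[S.μE] w - g :=
      (Lp.coeFn_sub _ _).trans (EventuallyEq.rfl.sub hgm.coeFn_toLp)
    rw [norm_sub_rev, Lp.norm_def, eLpNorm_congr_ae hae]
    exact ENNReal.toReal_le_of_le_ofReal (by positivity) hgw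
  obtain ⟨C, hC⟩ := hgc.bounded_above_of_compact_support hgs
  -- A sup bound of the continuous approximant `g` is the threshold for `α`: beyond it the radial
  -- grid reaches every value of `‖g‖`.
  refine ⟨C, fun α hα hCα => ?_⟩
  set K : ℝ := measureUnivNNReal S.μE ^ (2 : ℝ≥0∞).toReal⁻¹ with hK
  have hK0 : 0 ≤ K := by positivity
  -- Uniform error budget: `K = μ(E)^(1/2)` converts a sup bound into an `L₂` bound, and the `+ 1`
  -- covers `μ(E) = 0`.
  set ω : ℝ := η / (4 * (K + 1)) with hω
  have hω0 : 0 < ω := by positivity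
  have hKω : K * ω ≤ η / 4 := by
    rw [hω, mul_div_assoc', div_le_div_iff₀ (by positivity) (by norm_num)]
    nlinarith
  obtain ⟨θ, hθ, hunif⟩ := Metric.uniformContinuousOn_iff_le.mp
    (hE.uniformContinuousOn_of_continuous hgc.continuousOn) (ω / 3) (by positivity)
  -- One third of `ω` each for the oscillation of `g` on a piece, the radial rounding and the
  -- angular rounding; the last is scaled by a radius of at most `α`.
  refine ⟨min θ (min (ω / 3) (ω / (3 * α))), by positivity, ?_⟩
  intro Δ hΔ δ hδ σ hσ N Γ hΓ q r hr B hB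
  have hΔθ : Δ ≤ θ := hΔ.trans (min_le_left _ _)
  have hδω : δ ≤ ω / 3 := hδ.2.trans ((min_le_right _ _).trans (min_le_left _ _))
  have hσω : α * σ ≤ ω / 3 := by
    have : σ ≤ ω / (3 * α) := hσ.trans ((min_le_right _ _).trans (min_le_right _ _))
    calc α * σ ≤ α * (ω / (3 * α)) := by gcongr
      _ = ω / 3 := by field_simp
  obtain ⟨b₀, hb₀⟩ : B.Nonempty := by
    obtain ⟨b, hb, -⟩ := hB.cover (EuclideanSpace.single ⟨0, hm⟩ 1) (by simp)
    exact ⟨b, hb⟩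
  have hvalues : ∀ i, ∃ j, ∃ b ∈ B, ∀ s ∈ Γ i, ‖r j • b - g s‖ ≤ ω := by
    intro i
    rcases (Γ i).eq_empty_or_nonempty with hemp | ⟨s₀, hs₀⟩
    · exact ⟨0, b₀, hb₀, by simp [hemp]⟩
    · obtain ⟨j, b, hb, hjb⟩ := exists_smul_sphereNet_near hm hr hδ.1 hB ((hC s₀).trans hCα)
      refine ⟨j, b, hb, fun s hs => ?_⟩
      have h1 := hunif s₀ (hΓ.subset i hs₀) s (hΓ.subset i hs)
        (by rw [dist_eq_norm]; exact (hΓ.diam_le i _ hs₀ _ hs).trans hΔθ)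
      rw [dist_eq_norm] at h1
      have h2 : ‖g s₀‖ * σ ≤ ω / 3 := by
        rcases le_or_gt 0 σ with h0 | h0
        · exact (mul_le_mul_of_nonneg_right ((hC s₀).trans hCα) h0).trans hσω
        · nlinarith [norm_nonneg (g s₀)]
      calc ‖r j • b - g s‖ ≤ ‖r j • b - g s₀‖ + ‖g s₀ - g s‖ := norm_sub_le_norm_sub_add_norm_sub _ _ _
        _ ≤ ω := by linarith
  choose j b hb hjb using hvalues
  obtain ⟨v, hv⟩ := exists_piecewise_const hE hΓ fun i => r (j i) • b i
  have hvG : ‖v - hgm.toLp g‖ ≤ η / 4 := by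
    refine (Lp.norm_le_of_ae_bound hω0.le ?_).trans hKω
    filter_upwards [Lp.coeFn_sub v (hgm.toLp g), hgm.coeFn_toLp, ae_all_iff.mpr hv,
      ae_restrict_mem hE.measurableSet] with s h1 h2 h3 hsE
    rw [hΓ.union, mem_iUnion] at hsE
    obtain ⟨i, hi⟩ := hsE
    rw [h1, Pi.sub_apply, h2, h3 i hi]
    exact hjb i s hi
  have hvw : ‖v - w‖ ≤ η / 2 := by
    have := norm_sub_le_norm_sub_add_norm_sub v (hgm.toLp g) w
    linarith
  refine ⟨v, ⟨j, b, hb, hv, ?_⟩, ?_⟩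
  · have hvρ : ‖v‖ ≤ ρ := by
      have := norm_le_norm_add_norm_sub' v w
      linarith
    have hnorm := norm_sq_eq_of_piecewise_const hE hΓ hv
    simp_rw [norm_smul, hB.norm_eq _ (hb _), mul_one, Real.norm_eq_abs, sq_abs] at hnorm
    rw [← hnorm]
    gcongr
  · have := norm_sub_le_norm_sub_add_norm_sub v w u
    linarith

end UrysohnSystem

/-! ### Discrete trajectories and the main theorem. -/

namespace UrysohnSystem

variable {k n m : ℕ} {S : UrysohnSystem k n m} {γ₀ : EuclideanSpace ℝ (Fin k) → ℝ}
  {γ₁ γ₂ : EuclideanSpace ℝ (Fin k) × EuclideanSpace ℝ (Fin k) → ℝ}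

/-- Discrete trajectories approximate a given trajectory. -/
theorem exists_discreteZ_near (hm : 1 ≤ m) (hE : IsCompact S.E) (hlam : 0 ≤ S.lam) {ρ : ℝ}
    (hρ : 0 < ρ) (hA : S.CondA γ₀) (hB : S.CondB γ₁) (hC : S.CondC γ₂)
    (hD : S.CondD ρ (S.kappa₀ γ₀) (S.kappa₁ γ₁) (S.kappa₂ γ₂)) {x : S.StateSpace}
    (hx : x ∈ S.Z ρ) {ε : ℝ} (hε : 0 < ε) :
    ∃ M : ℝ, ∀ α, 0 < α → M ≤ α → ∃ τ : ℝ, 0 < τ ∧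
      ∀ Δ ≤ τ, ∀ δ ∈ Ioc 0 τ, ∀ σ ≤ τ,
      ∀ (N : ℕ) (Γ : Fin N → Set (EuclideanSpace ℝ (Fin k))), IsDeltaPartition S.E Δ Γ →
      ∀ (q : ℕ) (r : Fin (q + 1) → ℝ), IsUniformPartition α δ r →
      ∀ B : Finset (EuclideanSpace ℝ (Fin m)), IsSphereNet σ B →
        ∃ y ∈ S.discreteZ ρ Γ r B, ‖y - x‖ ≤ ε := by
  have := isFiniteMeasure_μE hE
  obtain ⟨u, hu, hux⟩ := hx
  obtain ⟨η, hη, hnear⟩ := exists_norm_trajectory_sub_le hA hB hC hlam hD hux hε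
  obtain ⟨M, hM⟩ := exists_discreteControls_near hm hE hρ hu hη
  refine ⟨M, fun α hα hMα => ?_⟩
  obtain ⟨τ, hτ, h⟩ := hM α hα hMα
  refine ⟨τ, hτ, fun Δ hΔ δ hδ σ hσ N Γ hΓ q r hr B hnet => ?_⟩
  obtain ⟨v, hv, hvu⟩ := h Δ hΔ δ hδ σ hσ N Γ hΓ q r hr B hnet
  have hvρ : ‖v‖ ≤ ρ := discreteControls_subset_admissible hE hΓ hρ.le hnet hv
  obtain ⟨y, hy, -⟩ := existsUnique_isTrajectory hA hB hC hlam hD hvρ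
  exact ⟨y, ⟨v, hv, hy⟩, hnear v hvρ hvu y hy⟩

/-- The grid starts at `0`, so zero radius on every piece is allowed; this gives nonemptiness of the
discrete trajectory set. -/
theorem zero_mem_discreteControls (hm : 1 ≤ m) {N q : ℕ} (ρ : ℝ)
    (Γ : Fin N → Set (EuclideanSpace ℝ (Fin k))) {r : Fin (q + 1) → ℝ} {α δ σ : ℝ}
    (hr : IsUniformPartition α δ r) {B : Finset (EuclideanSpace ℝ (Fin m))}
    (hB : IsSphereNet σ B) : (0 : S.ControlSpace) ∈ S.discreteControls ρ Γ r B := by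
  obtain ⟨b, hb, -⟩ := hB.cover (EuclideanSpace.single ⟨0, hm⟩ 1) (by simp)
  refine ⟨fun _ => 0, fun _ => b, fun _ => hb, fun i => ?_, ?_⟩
  · filter_upwards [Lp.coeFn_zero (EuclideanSpace ℝ (Fin m)) 2 S.μE] with s hs _
    rw [hs, hr.first, zero_smul, Pi.zero_apply]
  · simp only [hr.first]
    simpa using sq_nonneg ρ

end UrysohnSystem

theorem theorem3p1 {k n m : ℕ} (hm : 1 ≤ m) (S : UrysohnSystem k n m)
    (hE : IsCompact S.E) (hlam : 0 < S.lam) (ρ : ℝ) (hρ : 0 < ρ)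
    (γ₀ : EuclideanSpace ℝ (Fin k) → ℝ)
    (γ₁ γ₂ : EuclideanSpace ℝ (Fin k) × EuclideanSpace ℝ (Fin k) → ℝ)
    (hA : S.CondA γ₀) (hB : S.CondB γ₁) (hC : S.CondC γ₂)
    (hD : S.CondD ρ (S.kappa₀ γ₀) (S.kappa₁ γ₁) (S.kappa₂ γ₂)) :
    ∀ ε : ℝ, 0 < ε →
      ∃ αs : ℝ, 0 < αs ∧ ∃ Δs : ℝ, 0 < Δs ∧ ∃ δs : ℝ, 0 < δs ∧ ∃ σs : ℝ, 0 < σs ∧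
        ∀ Δ ∈ Set.Ioc 0 Δs, ∀ δ ∈ Set.Ioc 0 δs, ∀ σ ∈ Set.Ioc 0 σs,
        ∀ (N : ℕ) (Γ : Fin N → Set (EuclideanSpace ℝ (Fin k))), IsDeltaPartition S.E Δ Γ →
        ∀ (q : ℕ) (r : Fin (q + 1) → ℝ), IsUniformPartition αs δ r →
        ∀ B : Finset (EuclideanSpace ℝ (Fin m)), IsSphereNet σ B →
          (S.discreteZ ρ Γ r B).Nonempty ∧
          (S.discreteZ ρ Γ r B).Finite ∧
          S.discreteZ ρ Γ r B ⊆ S.Z ρ ∧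
          Metric.hausdorffEDist (S.Z ρ) (S.discreteZ ρ Γ r B) ≤
            ENNReal.ofReal
              ((S.cStar ρ (S.kappa₀ γ₀) (S.kappa₁ γ₁) (S.kappa₂ γ₂) + 1) * ε) := by

  intro ε hε
  have := UrysohnSystem.isFiniteMeasure_μE hE
  have hcompact := UrysohnSystem.isSeqCompact_Z hA hB hC hlam.le hD
  -- The net consists of points of `Z ρ` itself, so each of them can be approximated by discrete
  -- trajectories.
  obtain ⟨t, htZ, htfin, hcover⟩ :=
    Metric.finite_approx_of_totallyBounded hcompact.totallyBounded (ε / 2) (half_pos hε)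
  choose! M hM using fun x (hx : x ∈ t) =>
    UrysohnSystem.exists_discreteZ_near hm hE hlam.le hρ hA hB hC hD (htZ hx) (half_pos hε)
  -- `αs` must be fixed before the mesh bounds, since these depend on it; finiteness of the net
  -- yields a common value for each.
  obtain ⟨αs, hα, hMα⟩ : ∃ α : ℝ, 0 < α ∧ ∀ x ∈ t, M x ≤ α :=
    ((eventually_gt_atTop 0).and
      ((eventually_all_finite htfin).mpr fun x _ => eventually_ge_atTop (M x))).exists
  choose! τ' hτ' hnear using fun x (hx : x ∈ t) => hM x hx αs hα (hMα x hx)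
  obtain ⟨τ, hτ, hττ'⟩ : ∃ τ : ℝ, 0 < τ ∧ ∀ x ∈ t, τ ≤ τ' x := by
    have h1 : ∀ᶠ τ : ℝ in 𝓝[>] 0, 0 < τ := eventually_mem_nhdsWithin
    have h2 : ∀ᶠ τ : ℝ in 𝓝[>] 0, ∀ x ∈ t, τ ≤ τ' x :=
      (eventually_all_finite htfin).mpr fun x hx =>
        eventually_nhdsWithin_of_eventually_nhds (eventually_le_nhds (hτ' x hx))
    exact (h1.and h2).exists
  refine ⟨αs, hα, τ, hτ, τ, hτ, τ, hτ, ?_⟩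
  intro Δ hΔ δ hδ σ hσ N Γ hΓ q r hr B hnet
  have hsub := UrysohnSystem.discreteControls_subset_admissible hE hΓ hρ.le (r := r) hnet
  have hsubZ : S.discreteZ ρ Γ r B ⊆ S.Z ρ := fun x ⟨u, hu, hux⟩ => ⟨u, hsub hu, hux⟩
  refine ⟨?_, ?_, hsubZ, ?_⟩
  · have h0 := UrysohnSystem.zero_mem_discreteControls (S := S) hm ρ Γ hr hnet
    obtain ⟨x, hx, -⟩ := UrysohnSystem.existsUnique_isTrajectory hA hB hC hlam.le hD (hsub h0)
    exact ⟨x, 0, h0, hx⟩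
  · have hfin : (⋃ u ∈ S.discreteControls ρ Γ r B, {x | S.IsTrajectory u x}).Finite :=
      (UrysohnSystem.finite_discreteControls hE hΓ ρ r B).biUnion fun u hu =>
        Set.Subsingleton.finite fun x hx y hy =>
          (UrysohnSystem.existsUnique_isTrajectory hA hB hC hlam.le hD (hsub hu)).unique hx hy
    refine hfin.subset ?_
    rintro x ⟨u, hu, hux⟩
    exact mem_biUnion hu hux
  -- A real square root is nonnegative, so the sharper bound `ε` is enough.
  · have hε_le : ε ≤ (S.cStar ρ (S.kappa₀ γ₀) (S.kappa₁ γ₁) (S.kappa₂ γ₂) + 1) * ε :=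
      le_mul_of_one_le_left hε.le (le_add_of_nonneg_left (Real.sqrt_nonneg _))
    refine (Metric.hausdorffEDist_le_of_mem_edist (r := ENNReal.ofReal ε) ?_ ?_).trans
      (ENNReal.ofReal_le_ofReal hε_le)
    · intro x hx
      obtain ⟨z, hz, hxz⟩ := mem_iUnion₂.mp (hcover hx)
      obtain ⟨y, hy, hyz⟩ := hnear z hz Δ (hΔ.2.trans (hττ' z hz)) δ
        ⟨hδ.1, hδ.2.trans (hττ' z hz)⟩ σ (hσ.2.trans (hττ' z hz)) N Γ hΓ q r hr B hnet
      refine ⟨y, hy, ?_⟩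
      rw [edist_dist]
      refine ENNReal.ofReal_le_ofReal ((dist_triangle_right x y z).trans ?_)
      rw [← dist_eq_norm] at hyz
      have := Metric.mem_ball.mp hxz
      linarith
    · intro y hy
      exact ⟨y, hsubZ hy, by simp⟩
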